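/- A partition $\pi=(t_k)_{k\in\mathbb N}$ of $[0,\infty)$ consists of points $t_k\in[0,\infty]$ with $t_0=0$, $t_k<t_{k+1}$ whenever $t_{k+1}<\infty$, and $t_k\to\infty$. For a continuous $x:[0,\infty)\to\mathbb R$ let $$O_t(x,\pi)=\sup\{|x_b-x_a| : a,b\in[t_k,t_{k+1})\cap[0,t]\text{ for some }k\},$$ $$L^{x,\pi}_t(u)=2\sum_{j}\mathbf 1_{[\![ x_{t_j\wedge t},\,x_{t_{j+1}\wedge t})\!)}(u)\,|x_{t_{j+1}\wedge t}-u|,$$ where $[\![a,b)\!)$ is $[a,b)$ if $a\le b$ and $[b,a)$ if $a>b$. Fix a sequence $\Pi=(\pi_n)_n$ of partitions and $p\in[1,\infty]$ with conjugate exponent $q$. We write $x\in\mathcal L_p$ if $x$ is continuous, $O_t(x,\pi_n)\to0$ for all $t\ge0$, and there are $L^x_t\in L^p(\mathbb R,du)$, $t\ge 0$, such that for every $h\in L^q$: $\int L^{x,\pi_n}_t h\,du\to\int L^x_t h\,du$ for every $t\ge0$, and $t\mapsto\int L^x_t h\,du$ is continuous on $[0,\infty)$. (That is, $L^{x,\pi_n}_t\to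 L^x_t$ in the weak topology of $L^p$, weak* if $p=\infty$, and $t\mapsto L^x_t$ is continuous for that topology.) The a.e.-class $L^x_t$ is called the pathwise local time of $x$. **Proposition 4.1.** Let $x\in\mathcal L_p$ and let $f:\mathbb R\to\mathbb R$ be $C^1$ and strictly monotone. Then $f(x)\in\mathcal L_p$ along the same partitions $\Pi$, and the pathwise local times of $x$ and $f(x)$ are related by $$L^{f(x)}_t(f(u))=|f'(u)|\,L^x_t(u)$$ in the following sense: for every version of $L^x$ there is a version of $L^{f(x)}$ for which the identity holds for all $t\ge0$ and $u\in\mathbb R$; and for arbitrary versions of $L^x$ and $L^{f(x)}$ and every $t\ge0$ it holds for all $u$ with $f(u)\notin N_t$, for some Lebesgue-null set $N_t\subseteq\mathbb R$. -/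

import Mathlib

open Set Filter Topology MeasureTheory
open scoped NNReal ENNReal

noncomputable section

namespace PathwiseLocalTime

/-- A partition `0 = t₀ < t₁ < ...` of `[0, ∞)`, with points in `[0, ∞]` that increase strictly as
long as they are finite and tend to `∞`. The value `∞` may be attained (it is then repeated
forever), so that finite partitions are included. -/
structure TimePartition where
  /-- The points of the partition. -/
  pt : ℕ → ℝ≥0∞
  pt_zero : pt 0 = 0
  pt_lt_succ : ∀ k, pt (k + 1) < ∞ → pt k < pt (k + 1)
  tendsto_pt : Tendsto pt atTop (𝓝 ∞)

/-- The path stopped at time `t`, evaluated at `s ∈ [0, ∞]`: the number `x (s ∧ t)`. -/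
def stopped (x : ℝ≥0 → ℝ) (t : ℝ≥0) (s : ℝ≥0∞) : ℝ := x (min s (t : ℝ≥0∞)).toNNReal

/-- The oscillation of `x` along `π` up to time `t`: the supremum of `|x b - x a|` over `a, b` in
`[t_k, t_{k+1}) ∩ [0, t]` and over `k`, as an extended nonnegative number. -/
def osc (x : ℝ≥0 → ℝ) (π : TimePartition) (t : ℝ≥0) : ℝ≥0∞ :=
  ⨆ k : ℕ, ⨆ a ∈ {s : ℝ≥0 | π.pt k ≤ s ∧ s < π.pt (k + 1) ∧ s ≤ t},
    ⨆ b ∈ {s : ℝ≥0 | π.pt k ≤ s ∧ s < π.pt (k + 1) ∧ s ≤ t}, ENNReal.ofReal |x b - x a|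

/-- The discrete local time of `x` along `π` at time `t` and level `u`,
`2 ∑_j 1_{⟦x(t_j ∧ t), x(t_{j+1} ∧ t)⦆}(u) |x(t_{j+1} ∧ t) - u|`, where `⟦a, b⦆` is `[a, b)` if
`a ≤ b` and `[b, a)` otherwise. Only finitely many terms are nonzero, since `t_j ∧ t = t` for all
large `j`. -/
def discreteLocalTime (x : ℝ≥0 → ℝ) (π : TimePartition) (t : ℝ≥0) (u : ℝ) : ℝ :=
  2 * ∑' j : ℕ,
    (Ico (min (stopped x t (π.pt j)) (stopped x t (π.pt (j + 1))))
      (max (stopped x t (π.pt j)) (stopped x t (π.pt (j + 1))))).indicator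
      (fun v => |stopped x t (π.pt (j + 1)) - v|) u

/-- `L` is (a representative of) the pathwise local time of `x` along the sequence `P = (π_n)` of partitions, in the sense of
`L^p(du)`: for each `t` the discrete local times `L^{π_n}_t` converge to `L_t ∈ L^p` in the topology
`σ(L^p, L^q)`, where `1/p + 1/q = 1` (the weak topology for `p < ∞`, the weak-* topology for
`p = ∞`), and `t ↦ L_t` is continuous for this topology. -/
structure IsLocalTime (p : ℝ≥0∞) (P : ℕ → TimePartition) (x : ℝ≥0 → ℝ) (L : ℝ≥0 → ℝ → ℝ) :
    Prop where
  memLp : ∀ t, MemLp (L t) p volume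
  tendsto : ∀ t, ∀ h : ℝ → ℝ, MemLp h (ENNReal.conjExponent p) volume →
    Tendsto (fun n => ∫ u, discreteLocalTime x (P n) t u * h u) atTop (𝓝 (∫ u, L t u * h u))
  continuous : ∀ h : ℝ → ℝ, MemLp h (ENNReal.conjExponent p) volume →
    Continuous fun t => ∫ u, L t u * h u

/-- The class of continuous paths `x`, with oscillation along `P` tending to `0`, that possess a
pathwise local time along `P` in the sense of `L^p`. -/
structure HasLocalTime (p : ℝ≥0∞) (P : ℕ → TimePartition) (x : ℝ≥0 → ℝ) : Prop where
  continuous : Continuous x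
  tendsto_osc : ∀ t, Tendsto (fun n => osc x (P n) t) atTop (𝓝 0)
  exists_localTime : ∃ L, IsLocalTime p P x L

end PathwiseLocalTime

end

namespace PathwiseLocalTime

section Weights

variable {α : Type*} [MeasurableSpace α] {μ : Measure α} {w : α → ℝ≥0} {s : Set α} {C : ℝ≥0}
  {p : ℝ≥0∞}

theorem memLp_indicator_mul_of_memLp_withDensity (hp : 1 ≤ p) (hw : Measurable w)
    (hs : MeasurableSet s) (hC : ∀ u ∈ s, w u ≤ C) {H : α → ℝ}
    (hH : MemLp H p (μ.withDensity fun u => (w u : ℝ≥0∞))) :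
    MemLp (s.indicator fun u => (w u : ℝ) * H u) p μ := by
  have hmeas : AEStronglyMeasurable (s.indicator fun u => (w u : ℝ) * H u) μ :=
    ((aestronglyMeasurable_withDensity_iff hw).1 hH.1).indicator hs
  refine ⟨hmeas, ?_⟩
  rcases eq_or_ne p ∞ with rfl | hp'
  · have hb : ∀ᵐ u ∂μ.withDensity fun u => (w u : ℝ≥0∞),
        ‖H u‖ₑ ≤ eLpNormEssSup H (μ.withDensity fun u => (w u : ℝ≥0∞)) := enorm_ae_le_eLpNormEssSup _ _
    rw [ae_withDensity_iff hw.coe_nnreal_ennreal] at hb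
    have hfin := hH.2
    rw [eLpNorm_exponent_top] at hfin ⊢
    set B := eLpNormEssSup H (μ.withDensity fun u => (w u : ℝ≥0∞))
    refine lt_of_le_of_lt (essSup_le_of_ae_le (C * B) ?_) (ENNReal.mul_lt_top ENNReal.coe_lt_top hfin)
    filter_upwards [hb] with u hu
    by_cases hus : u ∈ s
    · rw [indicator_of_mem hus, enorm_mul]
      by_cases hw0 : w u = 0
      · simp [hw0]
      · have h1 : ‖(w u : ℝ)‖ₑ = w u := by simp [enorm, nnnorm]
        rw [h1]
        exact mul_le_mul' (by exact_mod_cast hC u hus) (hu (by simpa using hw0))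
    · simp [hus]
  · have hp0 : p ≠ 0 := (zero_lt_one.trans_le hp).ne'
    have hr : 1 ≤ p.toReal := by
      rw [← ENNReal.toReal_one]; exact ENNReal.toReal_mono hp' hp
    have hfin := hH.2
    rw [eLpNorm_lt_top_iff_lintegral_rpow_enorm_lt_top hp0 hp'] at hfin ⊢
    rw [lintegral_withDensity_eq_lintegral_mul_non_measurable _ hw.coe_nnreal_ennreal
      (by simp)] at hfin
    refine lt_of_le_of_lt (lintegral_mono (g := fun u => (C : ℝ≥0∞) ^ (p.toReal - 1) *
      ((fun u => (w u : ℝ≥0∞)) * fun u => ‖H u‖ₑ ^ p.toReal) u) fun u => ?_) ?_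
    · by_cases hus : u ∈ s
      · have h1 : ‖(w u : ℝ)‖ₑ = w u := by simp [enorm, nnnorm]
        simp only [indicator_of_mem hus, enorm_mul, h1, Pi.mul_apply]
        rw [ENNReal.mul_rpow_of_nonneg _ _ (by linarith), ← mul_assoc]
        gcongr
        have h2 : (w u : ℝ≥0∞) ^ p.toReal = (w u : ℝ≥0∞) ^ (p.toReal - 1) * w u := by
          conv_lhs => rw [show p.toReal = (p.toReal - 1) + 1 by ring]
          rw [ENNReal.rpow_add_of_nonneg _ _ (by linarith) zero_le_one, ENNReal.rpow_one]
        rw [h2]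
        gcongr
        exact hC u hus
      · simp [hus, zero_lt_one.trans_le hr]
    · rw [lintegral_const_mul' _ _ (ENNReal.rpow_ne_top_of_nonneg (by linarith) ENNReal.coe_ne_top)]
      exact ENNReal.mul_lt_top (ENNReal.rpow_lt_top_of_nonneg (by linarith) ENNReal.coe_ne_top) hfin

theorem memLp_withDensity_mul_of_memLp (hw : Measurable w)
    (hs : MeasurableSet s) (hC : ∀ u ∈ s, w u ≤ C) {G : α → ℝ} (hG : MemLp G p μ)
    (h0 : G =ᵐ[μ] s.indicator G) :
    MemLp (fun u => (w u : ℝ) * G u) p (μ.withDensity fun u => (w u : ℝ≥0∞)) := by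
  have hac : μ.withDensity (fun u => (w u : ℝ≥0∞)) ≪ μ := withDensity_absolutelyContinuous _ _
  have hle : (μ.withDensity fun u => (w u : ℝ≥0∞)).restrict s ≤ (C : ℝ≥0∞) • μ := by
    rw [restrict_withDensity hs, Measure.le_iff]
    intro t ht
    rw [withDensity_apply _ ht, Measure.smul_apply, smul_eq_mul]
    calc ∫⁻ a in t, (w a : ℝ≥0∞) ∂μ.restrict s ≤ ∫⁻ a in t, (C : ℝ≥0∞) ∂μ.restrict s := by
          refine lintegral_mono_ae (ae_restrict_of_ae ((ae_restrict_iff' hs).2 (.of_forall ?_)))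
          intro u hu
          exact_mod_cast hC u hu
      _ ≤ C * μ t := by
          rw [setLIntegral_const]
          gcongr
          exact Measure.restrict_le_self
  have h1 : MemLp (fun u => (w u : ℝ) * G u) p
      ((μ.withDensity fun u => (w u : ℝ≥0∞)).restrict s) := by
    refine (hG.of_measure_le_smul ENNReal.coe_ne_top hle).of_le_mul (c := C) ?_ ?_
    · exact hw.coe_nnreal_real.aestronglyMeasurable.mul ((hG.1.mono_ac hac).restrict)
    · refine (ae_restrict_iff' hs).2 (.of_forall fun u hu => ?_)
      rw [norm_mul]
      gcongr
      simpa using hC u hu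
  refine ((memLp_indicator_iff_restrict hs).2 h1).ae_eq ?_
  filter_upwards [hac.ae_eq h0] with u hu
  by_cases hus : u ∈ s
  · simp [hus]
  · simp only [indicator_of_notMem hus] at hu ⊢
    simp [hu]

theorem ae_eq_of_forall_integral_mul_eq [SigmaFinite μ] {q : ℝ≥0∞} [ENNReal.HolderConjugate p q]
    {A B : α → ℝ} (hA : MemLp A p μ) (hB : MemLp B p μ)
    (h : ∀ g : α → ℝ, MemLp g q μ → ∫ u, A u * g u ∂μ = ∫ u, B u * g u ∂μ) : A =ᵐ[μ] B := by
  have hp : 1 ≤ p := ENNReal.HolderConjugate.one_le p q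
  have key : ∀ (F : α → ℝ) (t : Set α), MeasurableSet t →
      ∫ u, F u * t.indicator (fun _ => (1 : ℝ)) u ∂μ = ∫ u in t, F u ∂μ := by
    intro F t ht
    rw [← integral_indicator ht]
    congr 1 with u
    by_cases hu : u ∈ t <;> simp [hu]
  have hint : ∀ {F : α → ℝ}, MemLp F p μ → ∀ t, MeasurableSet t → μ t < ∞ → IntegrableOn F t μ := by
    intro F hF t _ htop
    have : IsFiniteMeasure (μ.restrict t) := ⟨by simpa using htop⟩
    exact (hF.restrict t).integrable hp
  refine ae_eq_of_forall_setIntegral_eq_of_sigmaFinite (hint hA) (hint hB) fun t ht htop => ?_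
  rw [← key A t ht, ← key B t ht]
  exact h _ (memLp_indicator_const q ht 1 (Or.inr htop.ne))

end Weights

section ChangeOfVariables

variable {f : ℝ → ℝ}

theorem map_withDensity_nnnorm_deriv (hf : ContDiff ℝ 1 f) (hinj : f.Injective) :
    Measure.map f (volume.withDensity fun u => (‖deriv f u‖₊ : ℝ≥0∞)) =
      volume.restrict (range f) := by
  have h := map_withDensity_abs_det_fderiv_eq_addHaar (μ := (volume : Measure ℝ)) (s := univ) (f := f)
    (f' := fderiv ℝ f) MeasurableSet.univ.nullMeasurableSet
    (fun u _ => (hf.differentiable one_ne_zero u).hasFDerivAt.hasFDerivWithinAt) hinj.injOn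
  rw [Measure.restrict_univ, image_univ] at h
  rw [← h]
  congr 2 with u
  rw [← toSpanSingleton_deriv, ContinuousLinearMap.det_toSpanSingleton, ← Real.norm_eq_abs,
    ofReal_norm]
  rfl

theorem memLp_extend (hf : ContDiff ℝ 1 f) (hinj : f.Injective) {p : ℝ≥0∞} {F : ℝ → ℝ}
    (hF : MemLp F p (volume.withDensity fun u => (‖deriv f u‖₊ : ℝ≥0∞))) :
    MemLp (Function.extend f F 0) p volume := by
  have hemb := hf.continuous.measurableEmbedding hinj
  have h : Function.extend f F 0 = (range f).indicator (Function.extend f F 0) := by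
    ext v
    by_cases hv : v ∈ range f
    · simp [hv]
    · rw [indicator_of_notMem hv, Function.extend_apply' _ _ _ hv]; rfl
  rw [h, memLp_indicator_iff_restrict hemb.measurableSet_range,
    ← map_withDensity_nnnorm_deriv hf hinj, hemb.memLp_map_measure_iff,
    Function.extend_comp hinj]
  exact hF

theorem memLp_comp_withDensity (hf : ContDiff ℝ 1 f) (hinj : f.Injective) {p : ℝ≥0∞} {h : ℝ → ℝ}
    (hh : MemLp h p volume) :
    MemLp (h ∘ f) p (volume.withDensity fun u => (‖deriv f u‖₊ : ℝ≥0∞)) := by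
  rw [← (hf.continuous.measurableEmbedding hinj).memLp_map_measure_iff,
    map_withDensity_nnnorm_deriv hf hinj]
  exact hh.restrict _

theorem integral_eq_integral_abs_deriv_mul_comp (hf : ContDiff ℝ 1 f) (hinj : f.Injective)
    {F : ℝ → ℝ} (h0 : ∀ v ∉ range f, F v = 0) :
    ∫ v, F v = ∫ u, |deriv f u| * F (f u) := by
  have h := integral_image_eq_integral_abs_deriv_smul (s := univ) MeasurableSet.univ
    (fun u _ => (hf.differentiable one_ne_zero u).hasDerivAt.hasDerivWithinAt) hinj.injOn F
  rw [image_univ, Measure.restrict_univ, setIntegral_eq_integral_of_forall_compl_eq_zero h0] at h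
  simpa using h

end ChangeOfVariables

section Paths

variable {x : ℝ≥0 → ℝ} {π : TimePartition} {t : ℝ≥0} {f : ℝ → ℝ}

theorem stopped_eq_of_le {s : ℝ≥0∞} (h : (t : ℝ≥0∞) ≤ s) : stopped x t s = x t := by
  simp [stopped, min_eq_right h]

theorem stopped_coe_of_le {s : ℝ≥0} (h : s ≤ t) : stopped x t s = x s := by
  simp [stopped, min_eq_left (ENNReal.coe_le_coe.2 h)]

theorem exists_stopped_eq_comp (x : ℝ≥0 → ℝ) (t : ℝ≥0) (s : ℝ≥0∞) :
    ∃ r ≤ t, stopped x t s = x r :=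
  ⟨_, by simpa using ENNReal.toNNReal_mono ENNReal.coe_ne_top (min_le_right s (t : ℝ≥0∞)), rfl⟩

/-- The `j`-th summand of the discrete local time, without the factor `2`. -/
noncomputable def localTimeTerm (x : ℝ≥0 → ℝ) (π : TimePartition) (t : ℝ≥0) (j : ℕ) : ℝ → ℝ :=
  (Ico (min (stopped x t (π.pt j)) (stopped x t (π.pt (j + 1))))
    (max (stopped x t (π.pt j)) (stopped x t (π.pt (j + 1))))).indicator
    fun v => |stopped x t (π.pt (j + 1)) - v|

theorem exists_discreteLocalTime_eq_sum (π : TimePartition) (t : ℝ≥0) :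
    ∃ N : ℕ, ∀ (x : ℝ≥0 → ℝ) (u : ℝ),
      discreteLocalTime x π t u = 2 * ∑ j ∈ Finset.range N, localTimeTerm x π t j u := by
  obtain ⟨N, hN⟩ := eventually_atTop.1 (π.tendsto_pt.eventually
    (eventually_ge_nhds (show (t : ℝ≥0∞) < ∞ from ENNReal.coe_lt_top)))
  refine ⟨N, fun x u => ?_⟩
  rw [discreteLocalTime]
  congr 1
  refine tsum_eq_sum fun j hj => ?_
  have hj' : N ≤ j := by simpa using hj
  rw [stopped_eq_of_le (hN j hj'), stopped_eq_of_le (hN (j + 1) (by omega))]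
  simp

theorem memLp_localTimeTerm (x : ℝ≥0 → ℝ) (π : TimePartition) (t : ℝ≥0) (j : ℕ) (p : ℝ≥0∞) :
    MemLp (localTimeTerm x π t j) p volume := by
  rw [localTimeTerm, memLp_indicator_iff_restrict measurableSet_Ico]
  set a := stopped x t (π.pt j)
  set b := stopped x t (π.pt (j + 1))
  refine MemLp.of_bound (by fun_prop) (|b - a|) ((ae_restrict_iff' measurableSet_Ico).2
    (.of_forall fun u hu => ?_))
  rw [Real.norm_eq_abs, abs_abs]
  exact abs_sub_right_of_mem_uIcc ⟨hu.1, hu.2.le⟩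

theorem memLp_discreteLocalTime (x : ℝ≥0 → ℝ) (π : TimePartition) (t : ℝ≥0) (p : ℝ≥0∞) :
    MemLp (discreteLocalTime x π t) p volume := by
  obtain ⟨N, hN⟩ := exists_discreteLocalTime_eq_sum π t
  rw [funext (hN x)]
  exact (memLp_finsetSum _ fun j _ => memLp_localTimeTerm x π t j p).const_mul 2

theorem discreteLocalTime_eq_zero {s : Set ℝ} (hs : s.OrdConnected) (hx : ∀ r ≤ t, x r ∈ s)
    {u : ℝ} (hu : u ∉ s) : discreteLocalTime x π t u = 0 := by
  obtain ⟨N, hN⟩ := exists_discreteLocalTime_eq_sum π t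
  rw [hN, Finset.sum_eq_zero, mul_zero]
  intro j _
  refine indicator_of_notMem (fun h => hu ?_) _
  obtain ⟨r, hr, hr'⟩ := exists_stopped_eq_comp x t (π.pt j)
  obtain ⟨r₁, hr₁, hr₁'⟩ := exists_stopped_eq_comp x t (π.pt (j + 1))
  rw [hr', hr₁'] at h
  exact hs.uIcc_subset (hx r hr) (hx r₁ hr₁) ⟨h.1, h.2.le⟩

theorem le_osc {k : ℕ} {a b : ℝ≥0} (ha : π.pt k ≤ a) (ha' : (a : ℝ≥0∞) < π.pt (k + 1)) (hat : a ≤ t)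
    (hb : π.pt k ≤ b) (hb' : (b : ℝ≥0∞) < π.pt (k + 1)) (hbt : b ≤ t) :
    ENNReal.ofReal |x b - x a| ≤ osc x π t := by
  unfold osc
  refine le_iSup_of_le k (le_iSup₂_of_le a ⟨ha, ha', hat⟩ ?_)
  exact le_iSup₂_of_le (f := fun (b : ℝ≥0) _ => ENNReal.ofReal |x b - x a|) b ⟨hb, hb', hbt⟩ le_rfl

theorem ofReal_abs_stopped_succ_sub_le_osc (hx : Continuous x) (k : ℕ) :
    ENNReal.ofReal |stopped x t (π.pt (k + 1)) - stopped x t (π.pt k)| ≤ osc x π t := by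
  rcases lt_or_ge (t : ℝ≥0∞) (π.pt (k + 1)) with h | h
  · rw [stopped_eq_of_le h.le]
    rcases le_or_gt (t : ℝ≥0∞) (π.pt k) with h' | h'
    · simp [stopped_eq_of_le h']
    · obtain ⟨a, ha⟩ : ∃ a : ℝ≥0, (a : ℝ≥0∞) = _ := ⟨_, ENNReal.coe_toNNReal (h'.trans_le le_top).ne⟩
      rw [← ha] at h' ⊢
      have hat : a ≤ t := by exact_mod_cast h'.le
      rw [stopped_coe_of_le hat]
      exact le_osc ha.ge ((ENNReal.coe_le_coe.2 hat).trans_lt h) hat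
        (ha.ge.trans (ENNReal.coe_le_coe.2 hat)) h le_rfl
  · have hfin : π.pt (k + 1) < ∞ := h.trans_lt ENNReal.coe_lt_top
    have hlt := π.pt_lt_succ k hfin
    obtain ⟨a, ha⟩ : ∃ a : ℝ≥0, (a : ℝ≥0∞) = _ := ⟨_, ENNReal.coe_toNNReal (hlt.trans hfin).ne⟩
    obtain ⟨b, hb⟩ : ∃ b : ℝ≥0, (b : ℝ≥0∞) = _ := ⟨_, ENNReal.coe_toNNReal hfin.ne⟩
    rw [← ha, ← hb] at hlt ⊢
    rw [← hb] at h
    have hbt : b ≤ t := by exact_mod_cast h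
    have hab : a < b := by exact_mod_cast hlt
    rw [stopped_coe_of_le hbt, stopped_coe_of_le (hab.le.trans hbt)]
    have : NeBot (𝓝[<] b) := nhdsWithin_Iio_neBot' ⟨a, hab⟩ le_rfl
    have hlim : Tendsto (fun s => ENNReal.ofReal |x s - x a|) (𝓝[<] b)
        (𝓝 (ENNReal.ofReal |x b - x a|)) := by
      have : Continuous fun s => ENNReal.ofReal |x s - x a| :=
        ENNReal.continuous_ofReal.comp (hx.sub continuous_const).abs
      exact this.continuousWithinAt
    refine le_of_tendsto hlim ?_
    filter_upwards [Ioo_mem_nhdsLT hab] with s hs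
    refine le_osc ha.ge ?_ (hab.le.trans hbt) (ha.ge.trans (ENNReal.coe_le_coe.2 hs.1.le)) ?_
      (hs.2.le.trans hbt)
    · rw [← hb]; exact_mod_cast hab
    · rw [← hb]; exact_mod_cast hs.2

theorem osc_comp_le {C : ℝ≥0} {s : Set ℝ} (hf : LipschitzOnWith C f s) (hx : ∀ r ≤ t, x r ∈ s) :
    osc (f ∘ x) π t ≤ C * osc x π t := by
  conv_lhs => unfold osc
  refine iSup_le fun k => iSup₂_le fun a ha => iSup₂_le fun b hb => ?_
  calc ENNReal.ofReal |(f ∘ x) b - (f ∘ x) a|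
      ≤ ENNReal.ofReal (C * |x b - x a|) :=
        ENNReal.ofReal_le_ofReal (by
          simpa [Real.dist_eq] using hf.dist_le_mul (x b) (hx b hb.2.2) (x a) (hx a ha.2.2))
    _ = C * ENNReal.ofReal |x b - x a| := by
        rw [ENNReal.ofReal_mul C.coe_nonneg, ENNReal.ofReal_coe_nnreal]
    _ ≤ C * osc x π t := by
        gcongr
        exact le_osc ha.1 ha.2.1 ha.2.2 hb.1 hb.2.1 hb.2.2

theorem mem_Ico_min_max_iff {a b u : ℝ} (ha : u ≠ a) (hb : u ≠ b) :
    u ∈ Ico (min a b) (max a b) ↔ a < u ∧ u < b ∨ b < u ∧ u < a := by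
  simp only [mem_Ico, min_le_iff, lt_max_iff]
  constructor
  · rintro ⟨h | h, h' | h'⟩
    · exact absurd h (not_le.2 h')
    · exact Or.inl ⟨lt_of_le_of_ne h ha.symm, h'⟩
    · exact Or.inr ⟨lt_of_le_of_ne h hb.symm, h'⟩
    · exact absurd h (not_le.2 h')
  · rintro (⟨h, h'⟩ | ⟨h, h'⟩)
    · exact ⟨Or.inl h.le, Or.inr h'⟩
    · exact ⟨Or.inr h.le, Or.inl h'⟩

theorem comp_mem_Ico_min_max_iff (hmono : StrictMono f ∨ StrictAnti f) {a b u : ℝ} (ha : u ≠ a)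
    (hb : u ≠ b) :
    f u ∈ Ico (min (f a) (f b)) (max (f a) (f b)) ↔ u ∈ Ico (min a b) (max a b) := by
  have hinj : f.Injective := hmono.elim StrictMono.injective StrictAnti.injective
  rw [mem_Ico_min_max_iff ha hb, mem_Ico_min_max_iff (hinj.ne ha) (hinj.ne hb)]
  rcases hmono with h | h
  · simp only [h.lt_iff_lt]
  · simp only [h.lt_iff_gt]
    tauto

/-- If `f` is uniformly approximated by its tangents on a set containing the path, then the discrete
local time of `f ∘ x` is comparable to that of `x`. -/
theorem abs_discreteLocalTime_comp_sub_le (hx : Continuous x) (hmono : StrictMono f ∨ StrictAnti f)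
    {s : Set ℝ} (hs : s.OrdConnected) (hxs : ∀ r ≤ t, x r ∈ s) {ε δ : ℝ} (hδ0 : 0 ≤ δ)
    (hδ : ∀ u ∈ s, ∀ b ∈ s, |b - u| ≤ δ → |f b - f u - deriv f u * (b - u)| ≤ ε * |b - u|)
    (hosc : osc x π t ≤ ENNReal.ofReal δ) {u : ℝ} (hu : ∀ j, u ≠ stopped x t (π.pt j)) :
    |discreteLocalTime (f ∘ x) π t (f u) - |deriv f u| * discreteLocalTime x π t u| ≤
      ε * discreteLocalTime x π t u := by
  have hmem : ∀ r, stopped x t r ∈ s := fun r => by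
    obtain ⟨r', hr', h⟩ := exists_stopped_eq_comp x t r
    rw [h]; exact hxs r' hr'
  have key : ∀ j, |localTimeTerm (f ∘ x) π t j (f u) - |deriv f u| * localTimeTerm x π t j u| ≤
      ε * localTimeTerm x π t j u := by
    intro j
    have hiff := comp_mem_Ico_min_max_iff hmono (hu j) (hu (j + 1))
    have hcomp : ∀ r, stopped (f ∘ x) t r = f (stopped x t r) := fun _ => rfl
    have hstep : |stopped x t (π.pt (j + 1)) - stopped x t (π.pt j)| ≤ δ :=
      (ENNReal.ofReal_le_ofReal_iff hδ0).1
        ((ofReal_abs_stopped_succ_sub_le_osc hx j).trans hosc)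
    have ha := hmem (π.pt j)
    have hb := hmem (π.pt (j + 1))
    simp only [localTimeTerm, hcomp]
    set a := stopped x t (π.pt j)
    set b := stopped x t (π.pt (j + 1))
    by_cases h : u ∈ Ico (min a b) (max a b)
    · rw [indicator_of_mem h, indicator_of_mem (hiff.2 h)]
      have hub : u ∈ uIcc a b := ⟨h.1, h.2.le⟩
      have hdist : |b - u| ≤ δ := (abs_sub_right_of_mem_uIcc hub).trans hstep
      refine le_trans ?_ (hδ u (hs.uIcc_subset ha hb hub) b hb hdist)
      rw [← abs_mul]
      exact abs_abs_sub_abs_le _ _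
    · rw [indicator_of_notMem h, indicator_of_notMem (fun h' => h (hiff.1 h'))]
      simp
  obtain ⟨N, hN⟩ := exists_discreteLocalTime_eq_sum π t
  rw [hN, hN, mul_left_comm, ← mul_sub, mul_left_comm ε, abs_mul, abs_two, Finset.mul_sum,
    Finset.mul_sum, ← Finset.sum_sub_distrib]
  gcongr
  exact (Finset.abs_sum_le_sum_abs _ _).trans (Finset.sum_le_sum fun j _ => key j)

theorem exists_forall_abs_sub_deriv_mul_le (hf : ContDiff ℝ 1 f) {s : Set ℝ} (hs : IsCompact s)
    (hs' : s.OrdConnected) {ε : ℝ} (hε : 0 < ε) :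
    ∃ δ > 0, ∀ u ∈ s, ∀ b ∈ s, |b - u| ≤ δ →
      |f b - f u - deriv f u * (b - u)| ≤ ε * |b - u| := by
  have hc : Continuous (deriv f) := hf.continuous_deriv le_rfl
  obtain ⟨δ, hδ, H⟩ := Metric.uniformContinuousOn_iff.1
    (hs.uniformContinuousOn_of_continuous hc.continuousOn) ε hε
  refine ⟨δ / 2, by positivity, fun u hu b hb hbu => ?_⟩
  have hd : ∀ v ∈ uIcc u b, HasDerivWithinAt (fun v => f v - deriv f u * v)
      (deriv f v - deriv f u) (uIcc u b) v := fun v _ => by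
    have h := ((hf.differentiable one_ne_zero v).hasDerivAt.sub
      ((hasDerivAt_id v).const_mul (deriv f u))).hasDerivWithinAt
        (s := uIcc u b)
    rwa [mul_one] at h
  have := (convex_uIcc u b).norm_image_sub_le_of_norm_hasDerivWithin_le (C := ε) hd (fun v hv => ?_)
    left_mem_uIcc right_mem_uIcc
  · rw [Real.norm_eq_abs, Real.norm_eq_abs] at this
    convert! this using 2
    ring
  · refine (H v (hs'.uIcc_subset hu hb hv) u hu ?_).le
    rw [Real.dist_eq]
    have := abs_sub_left_of_mem_uIcc hv
    linarith

end Paths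

variable {x : ℝ≥0 → ℝ} {π : TimePartition} {t : ℝ≥0} {f : ℝ → ℝ} {p : ℝ≥0∞}
  {P : ℕ → TimePartition} {L M : ℝ≥0 → ℝ → ℝ}

theorem exists_forall_mem_Icc (hx : Continuous x) (T : ℝ≥0) :
    ∃ R : ℝ, ∀ r ≤ T, x r ∈ Icc (-R) R := by
  obtain ⟨R, hR⟩ := (isCompact_Icc (a := 0) (b := T)).exists_bound_of_continuousOn hx.continuousOn
  exact ⟨R, fun r hr => abs_le.1 (hR r ⟨zero_le, hr⟩)⟩

theorem IsLocalTime.ae_eq (hp : 1 ≤ p) (hL : IsLocalTime p P x L) (hM : IsLocalTime p P x M)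
    (t : ℝ≥0) : L t =ᵐ[volume] M t := by
  have := ENNReal.HolderConjugate.conjExponent hp
  exact ae_eq_of_forall_integral_mul_eq (q := ENNReal.conjExponent p) (hL.memLp t) (hM.memLp t) fun g hg =>
    tendsto_nhds_unique (hL.tendsto t g hg) (hM.tendsto t g hg)

theorem IsLocalTime.ae_eq_indicator (hp : 1 ≤ p) (hL : IsLocalTime p P x L) {s : Set ℝ}
    (hs : s.OrdConnected) (hxs : ∀ r ≤ t, x r ∈ s) : L t =ᵐ[volume] s.indicator (L t) := by
  have := ENNReal.HolderConjugate.conjExponent hp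
  have hsm := hs.measurableSet
  refine ae_eq_of_forall_integral_mul_eq (q := ENNReal.conjExponent p) (hL.memLp t)
    ((hL.memLp t).indicator hsm) fun g hg => ?_
  refine tendsto_nhds_unique (hL.tendsto t g hg) ?_
  convert! hL.tendsto t _ (hg.indicator hsm) using 2
  · congr 1 with u
    by_cases hu : u ∈ s
    · simp [hu]
    · simp [discreteLocalTime_eq_zero hs hxs hu]
  · congr 1 with u
    by_cases hu : u ∈ s <;> simp [hu]

theorem osc_comp_tendsto (hx : Continuous x)
    (hosc : ∀ t, Tendsto (fun n => osc x (P n) t) atTop (𝓝 0)) (hf : ContDiff ℝ 1 f) (t : ℝ≥0) :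
    Tendsto (fun n => osc (f ∘ x) (P n) t) atTop (𝓝 0) := by
  obtain ⟨R, hR⟩ := exists_forall_mem_Icc hx t
  obtain ⟨C, hC⟩ := hf.contDiffOn.exists_lipschitzOnWith one_ne_zero (convex_Icc (-R) R)
    isCompact_Icc
  have h := ENNReal.Tendsto.const_mul (a := (C : ℝ≥0∞)) (hosc t) (Or.inr ENNReal.coe_ne_top)
  rw [mul_zero] at h
  exact tendsto_of_tendsto_of_tendsto_of_le_of_le tendsto_const_nhds h (fun _ => zero_le)
    fun n => osc_comp_le hC hR

/-- The test function `|f'| (h ∘ f)`, cut off outside `s`. -/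
noncomputable def pullbackTest (f h : ℝ → ℝ) (s : Set ℝ) : ℝ → ℝ :=
  s.indicator fun u => |deriv f u| * h (f u)

section Pullback

variable {s : Set ℝ} {h : ℝ → ℝ} {q : ℝ≥0∞} {C : ℝ≥0}

theorem memLp_pullbackTest (hf : ContDiff ℝ 1 f) (hinj : f.Injective) (hq : 1 ≤ q)
    (hs : MeasurableSet s) (hC : ∀ u ∈ s, ‖deriv f u‖₊ ≤ C) (hh : MemLp h q volume) :
    MemLp (pullbackTest f h s) q volume :=
  memLp_indicator_mul_of_memLp_withDensity hq (hf.continuous_deriv le_rfl).measurable.nnnorm hs hC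
    (memLp_comp_withDensity hf hinj hh)

theorem memLp_abs_deriv_mul_pullbackTest (hf : ContDiff ℝ 1 f) (hinj : f.Injective) (hq : 1 ≤ q)
    (hs : MeasurableSet s) (hC : ∀ u ∈ s, ‖deriv f u‖₊ ≤ C) (hh : MemLp h q volume) :
    MemLp (fun u => |deriv f u| * pullbackTest f h s u) q volume := by
  have hg := memLp_pullbackTest hf hinj hq hs hC hh
  have hm : Measurable fun u => |deriv f u| := (hf.continuous_deriv le_rfl).abs.measurable
  refine hg.of_le_mul (c := C) (hm.aestronglyMeasurable.mul hg.1) (.of_forall fun u => ?_)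
  by_cases hu : u ∈ s
  · rw [norm_mul]
    gcongr
    simpa using NNReal.coe_le_coe.2 (hC u hu)
  · simp [pullbackTest, hu]

theorem memLp_extend_localTime (hp : 1 ≤ p) (hL : IsLocalTime p P x L) (hf : ContDiff ℝ 1 f)
    (hinj : f.Injective) (hs : s.OrdConnected) (hxs : ∀ r ≤ t, x r ∈ s)
    (hC : ∀ u ∈ s, ‖deriv f u‖₊ ≤ C) :
    MemLp (Function.extend f (fun u => |deriv f u| * L t u) 0) p volume :=
  memLp_extend hf hinj (memLp_withDensity_mul_of_memLp
    (hf.continuous_deriv le_rfl).measurable.nnnorm hs.measurableSet hC (hL.memLp t)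
    (hL.ae_eq_indicator hp hs hxs))

theorem integral_extend_mul (hp : 1 ≤ p) (hL : IsLocalTime p P x L) (hf : ContDiff ℝ 1 f)
    (hinj : f.Injective) (hs : s.OrdConnected) (hxs : ∀ r ≤ t, x r ∈ s) :
    ∫ v, Function.extend f (fun u => |deriv f u| * L t u) 0 v * h v =
      ∫ u, L t u * (|deriv f u| * pullbackTest f h s u) := by
  rw [integral_eq_integral_abs_deriv_mul_comp hf hinj]
  · refine integral_congr_ae ?_
    filter_upwards [hL.ae_eq_indicator hp hs hxs] with u hu
    rw [hinj.extend_apply]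
    by_cases hus : u ∈ s
    · rw [pullbackTest, indicator_of_mem hus]; ring
    · rw [indicator_of_notMem hus] at hu
      simp [hu]
  · intro v hv
    rw [Function.extend_apply' _ _ _ hv]
    simp

theorem discreteLocalTime_comp_mul_pullbackTest (hf : Continuous f) (hinj : f.Injective)
    (hs : s.OrdConnected) (hxs : ∀ r ≤ t, x r ∈ s) (u : ℝ) :
    discreteLocalTime (f ∘ x) π t (f u) * pullbackTest f h s u =
      |deriv f u| * (discreteLocalTime (f ∘ x) π t (f u) * h (f u)) := by
  by_cases hu : u ∈ s
  · rw [pullbackTest, indicator_of_mem hu]; ring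
  · rw [discreteLocalTime_eq_zero (s := f '' s)
      (hs.isPreconnected.image f hf.continuousOn).ordConnected
      (x := f ∘ x) (fun r hr => mem_image_of_mem f (hxs r hr)) (by rwa [hinj.mem_set_image])]
    simp

theorem integral_discreteLocalTime_comp_mul (hf : ContDiff ℝ 1 f) (hinj : f.Injective)
    (hs : s.OrdConnected) (hxs : ∀ r ≤ t, x r ∈ s) :
    ∫ v, discreteLocalTime (f ∘ x) π t v * h v =
      ∫ u, discreteLocalTime (f ∘ x) π t (f u) * pullbackTest f h s u := by
  rw [integral_eq_integral_abs_deriv_mul_comp hf hinj]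
  · congr 1 with u
    rw [discreteLocalTime_comp_mul_pullbackTest hf.continuous hinj hs hxs]
  · intro v hv
    rw [discreteLocalTime_eq_zero (s := range f) (isPreconnected_range hf.continuous).ordConnected
      (x := f ∘ x) (fun r _ => mem_range_self (x r)) hv, zero_mul]

theorem integrable_discreteLocalTime_comp_mul [ENNReal.HolderConjugate p q] (hf : ContDiff ℝ 1 f)
    (hinj : f.Injective) (hs : s.OrdConnected) (hxs : ∀ r ≤ t, x r ∈ s) (hh : MemLp h q volume) :
    Integrable fun u => discreteLocalTime (f ∘ x) π t (f u) * pullbackTest f h s u := by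
  have h1 : Integrable fun v => discreteLocalTime (f ∘ x) π t v * h v :=
    (memLp_discreteLocalTime (f ∘ x) π t p).integrable_mul hh
  have h2 := (integrableOn_image_iff_integrableOn_abs_deriv_smul (s := univ) MeasurableSet.univ
    (fun u _ => (hf.differentiable one_ne_zero u).hasDerivAt.hasDerivWithinAt) hinj.injOn _).1
    h1.integrableOn
  rw [integrableOn_univ] at h2
  refine h2.congr (.of_forall fun u => ?_)
  exact (discreteLocalTime_comp_mul_pullbackTest hf.continuous hinj hs hxs u).symm

theorem abs_integral_discreteLocalTime_comp_sub_le [ENNReal.HolderConjugate p q]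
    (hx : Continuous x) (hf : ContDiff ℝ 1 f) (hmono : StrictMono f ∨ StrictAnti f)
    (hs : s.OrdConnected) (hxs : ∀ r ≤ t, x r ∈ s) (hC : ∀ u ∈ s, ‖deriv f u‖₊ ≤ C)
    (hh : MemLp h q volume) {ε δ : ℝ} (hδ0 : 0 ≤ δ)
    (hδ : ∀ u ∈ s, ∀ b ∈ s, |b - u| ≤ δ → |f b - f u - deriv f u * (b - u)| ≤ ε * |b - u|)
    (hosc : osc x π t ≤ ENNReal.ofReal δ) :
    |(∫ v, discreteLocalTime (f ∘ x) π t v * h v) -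
        ∫ u, discreteLocalTime x π t u * (|deriv f u| * pullbackTest f h s u)| ≤
      ε * ∫ u, discreteLocalTime x π t u * |pullbackTest f h s u| := by
  have hinj : f.Injective := hmono.elim StrictMono.injective StrictAnti.injective
  have hq : 1 ≤ q := ENNReal.HolderConjugate.one_le q p
  have hg := memLp_pullbackTest hf hinj hq hs.measurableSet hC hh
  have hg' := memLp_abs_deriv_mul_pullbackTest hf hinj hq hs.measurableSet hC hh
  have hD := memLp_discreteLocalTime x π t p
  have hint : Integrable fun u =>
      discreteLocalTime x π t u * (|deriv f u| * pullbackTest f h s u) := hD.integrable_mul hg'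
  rw [integral_discreteLocalTime_comp_mul hf hinj hs hxs,
    ← integral_sub (integrable_discreteLocalTime_comp_mul (p := p) hf hinj hs hxs hh)
      hint, ← Real.norm_eq_abs, ← integral_const_mul]
  refine norm_integral_le_of_norm_le ((hD.integrable_mul hg.abs).const_mul ε) ?_
  have hnull : ∀ᵐ u : ℝ, u ∉ range fun j => stopped x t (π.pt j) :=
    (countable_range _).ae_notMem volume
  filter_upwards [hnull] with u hu
  have hb := abs_discreteLocalTime_comp_sub_le hx hmono hs hxs hδ0 hδ hosc
    (fun j hj => hu ⟨j, hj.symm⟩)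
  rw [Real.norm_eq_abs, ← mul_assoc, ← sub_mul, abs_mul, ← mul_assoc, mul_comm _ |deriv f u|]
  gcongr

end Pullback

theorem IsLocalTime.comp (hp : 1 ≤ p) (hx : Continuous x)
    (hosc : ∀ t, Tendsto (fun n => osc x (P n) t) atTop (𝓝 0)) (hL : IsLocalTime p P x L)
    (hf : ContDiff ℝ 1 f) (hmono : StrictMono f ∨ StrictAnti f) :
    IsLocalTime p P (f ∘ x) fun t => Function.extend f (fun u => |deriv f u| * L t u) 0 := by
  have hpq := ENNReal.HolderConjugate.conjExponent hp
  have hq : 1 ≤ ENNReal.conjExponent p := ENNReal.HolderConjugate.one_le _ p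
  have hinj : f.Injective := hmono.elim StrictMono.injective StrictAnti.injective
  have hbox : ∀ T, ∃ R : ℝ, ∃ C : ℝ≥0, (∀ r ≤ T, x r ∈ Icc (-R) R) ∧
      ∀ u ∈ Icc (-R) R, ‖deriv f u‖₊ ≤ C := fun T => by
    obtain ⟨R, hR⟩ := exists_forall_mem_Icc hx T
    obtain ⟨C, hC⟩ := (isCompact_Icc (a := -R) (b := R)).exists_bound_of_continuousOn
      (hf.continuous_deriv le_rfl).continuousOn
    exact ⟨R, C.toNNReal, hR, fun u hu => NNReal.le_toNNReal_of_coe_le (hC u hu)⟩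
  refine ⟨fun t => ?_, fun t h hh => ?_, fun h hh => ?_⟩
  · obtain ⟨R, C, hR, hC⟩ := hbox t
    exact memLp_extend_localTime hp hL hf hinj ordConnected_Icc hR hC
  · obtain ⟨R, C, hR, hC⟩ := hbox t
    rw [integral_extend_mul hp hL hf hinj ordConnected_Icc hR]
    have hlim := hL.tendsto t _
      (memLp_abs_deriv_mul_pullbackTest hf hinj hq measurableSet_Icc hC hh)
    have hlim' := hL.tendsto t _ (memLp_pullbackTest hf hinj hq measurableSet_Icc hC hh).abs
    set g := pullbackTest f h (Icc (-R) R)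
    set c := ∫ u, L t u * |g u|
    have hdiff : Tendsto (fun n => (∫ v, discreteLocalTime (f ∘ x) (P n) t v * h v) -
        ∫ u, discreteLocalTime x (P n) t u * (|deriv f u| * g u)) atTop (𝓝 0) := by
      rw [Metric.tendsto_nhds]
      intro η hη
      have hc : 0 < |c| + 1 := by positivity
      obtain ⟨δ, hδ0, hδ⟩ := exists_forall_abs_sub_deriv_mul_le hf (isCompact_Icc (a := -R) (b := R))
        ordConnected_Icc (ε := η / (|c| + 1)) (by positivity)
      filter_upwards [(hosc t).eventually (eventually_le_nhds (ENNReal.ofReal_pos.2 hδ0)),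
        hlim'.eventually (eventually_lt_nhds ((le_abs_self c).trans_lt (lt_add_one _)))] with n h1 h2
      rw [Real.dist_eq, sub_zero]
      refine (abs_integral_discreteLocalTime_comp_sub_le (p := p) hx hf hmono ordConnected_Icc hR hC
        hh hδ0.le hδ h1).trans_lt ?_
      rw [div_mul_eq_mul_div, div_lt_iff₀ hc]
      exact mul_lt_mul_of_pos_left h2 hη
    simpa using hdiff.add hlim
  · refine continuous_iff_continuousAt.2 fun t => ?_
    obtain ⟨R, C, hR, hC⟩ := hbox (t + 1)
    refine ((hL.continuous _ (memLp_abs_deriv_mul_pullbackTest hf hinj hq measurableSet_Icc hC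
      hh)).continuousAt (x := t)).congr ?_
    filter_upwards [Iic_mem_nhds (show t < t + 1 from lt_add_one t)] with r hr
    rw [integral_extend_mul hp hL hf hinj ordConnected_Icc fun r' hr' => hR r' (hr'.trans hr)]

end PathwiseLocalTime

theorem proposition4p1 (p : ℝ≥0∞) (hp : 1 ≤ p) (P : ℕ → PathwiseLocalTime.TimePartition)
    (x : ℝ≥0 → ℝ) (hx : PathwiseLocalTime.HasLocalTime p P x)
    (f : ℝ → ℝ) (hf : ContDiff ℝ 1 f) (hmono : StrictMono f ∨ StrictAnti f) :
    PathwiseLocalTime.HasLocalTime p P (f ∘ x) ∧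
    (∀ L : ℝ≥0 → ℝ → ℝ, PathwiseLocalTime.IsLocalTime p P x L →
      ∃ M : ℝ≥0 → ℝ → ℝ, PathwiseLocalTime.IsLocalTime p P (f ∘ x) M ∧
        ∀ t u, M t (f u) = |deriv f u| * L t u) ∧
    (∀ L M : ℝ≥0 → ℝ → ℝ, PathwiseLocalTime.IsLocalTime p P x L →
      PathwiseLocalTime.IsLocalTime p P (f ∘ x) M →
        ∀ t, ∀ᵐ v : ℝ, ∀ u, f u = v → M t v = |deriv f u| * L t u) := by
  have hinj : f.Injective := hmono.elim StrictMono.injective StrictAnti.injective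
  have hcomp := fun L (hL : PathwiseLocalTime.IsLocalTime p P x L) =>
    hL.comp hp hx.continuous hx.tendsto_osc hf hmono
  refine ⟨⟨hf.continuous.comp hx.continuous,
    PathwiseLocalTime.osc_comp_tendsto hx.continuous hx.tendsto_osc hf,
    hx.exists_localTime.imp' _ hcomp⟩, fun L hL => ⟨_, hcomp L hL, fun t u => hinj.extend_apply _ _ u⟩,
    fun L M hL hM t => ?_⟩
  filter_upwards [hM.ae_eq hp (hcomp L hL) t] with v hv u hu
  rw [hv, ← hu, hinj.extend_apply]
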